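/- Let $\alpha=(\alpha_1,\dots,\alpha_n)$ be a weak composition (parts $\alpha_r\ge 0$) and $\sigma\in S_n$. A filling of shape $\alpha$ with big basement $\sigma$ has rows $1,\dots,n$ from top to bottom. Row $r$ has the basement box $(r,0)$ with entry $\infty_{\sigma_r}$, followed by boxes $(r,1),\dots,(r,\alpha_r)$ filled with arbitrary natural numbers; here $\infty_1<\infty_2<\dots<\infty_n$ and $k<\infty_i$ for all natural numbers $k$ and all $i$. A triple of type A consists of boxes $a=(r,c)$, $b=(r,c+1)$, $c'=(s,c+1)$ with $r<s$ and $\alpha_s\le\alpha_r$. A triple of type B consists of boxes $a=(r,c)$, $b=(r,c+1)$, $c'=(s,c)$ with $s<r$ and $\alpha_s<\alpha_r$. (Basement boxes are allowed.) Give $a,b,c'$ the subscripts $3,1,2$ and regard the one of two equal entries with the larger subscript as larger. A triple of type A is an inversion triple if its entries, ordered increasingly, form a counter-clockwise orientation; a triple of type B is an inversion triple if its entries, ordered increasingly, form a clockwise orientation. (In both cases: if the boxes in increasing order of their entries are, up to cyclic rotation, $a,c',b$.) Let $\mathrm{InvFree}(\alpha,\sigma)$ be the set of fillings of shape $\alpha$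 with big basement $\sigma$ that have no inversion triple. The major index $\mathrm{maj}(F)$ is the sum of $\mathrm{leg}(u)+1$ over all non-basement boxes $u$ whose entry is strictly larger than the entry immediately to the left, where $\mathrm{leg}(u)$ is the number of boxes to the right of $u$ in its row. The column sets of $F$ are the multisets of entries of its columns, in order, the basement column included. Let $s_i$ act on $\alpha$ and on $\sigma=(\sigma_1,\dots,\sigma_n)$ by interchanging the entries in positions $i$ and $i+1$. **Proposition.** Let $1\le i<n$, and suppose $\sigma_i>\sigma_{i+1}$ and $\alpha_i\ge\alpha_{i+1}$. Then there is a bijection $$\varphi:\mathrm{InvFree}(\alpha,\sigma)\longrightarrow\mathrm{InvFree}(s_i\alpha,s_i\sigma)$$ such that, for every $F\in\mathrm{InvFree}(\alpha,\sigma)$, the fillings $F$ and $\varphi(F)$ have the same column sets and the same major index. -/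

import Mathlib

namespace BigBasement

/-- The entries of an augmented filling with a big basement: the natural numbers `k`, all of them
smaller than the infinities `∞_0 < ∞_1 < ⋯ < ∞_{n-1}` (lexicographic order on the sum). -/
abbrev Entry (n : ℕ) : Type := Lex (ℕ ⊕ Fin n)

/-- The finite entry `k`. -/
def Entry.fin {n : ℕ} (k : ℕ) : Entry n := toLex (Sum.inl k)

/-- The infinite entry `∞_i`. -/
def Entry.inf {n : ℕ} (i : Fin n) : Entry n := toLex (Sum.inr i)

/-- The non-basement part of a filling of shape `α`, a weak composition with `n` parts: row `r`
(counted from the top) carries `α r` natural numbers. -/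
abbrev Filling {n : ℕ} (α : Fin n → ℕ) : Type := (r : Fin n) → Fin (α r) → ℕ

section

variable {n : ℕ} {α : Fin n → ℕ}

/-- Row `r` of the augmented filling: the basement entry `∞_{σ r}` in column `0`, followed by the
`α r` natural numbers in row `r` of `F`, in columns `1, …, α r`. -/
def augEntry (σ : Equiv.Perm (Fin n)) (F : Filling α) (r : Fin n) : Fin (α r + 1) → Entry n :=
  Fin.cons (Entry.inf (σ r)) (fun j => Entry.fin (F r j))

/-- Three distinct elements of a linear order, listed increasingly, are met in the cyclic order
`x → y → z → x`. -/
def CyclicallyIncreasing {β : Type*} [LinearOrder β] (x y z : β) : Prop :=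
  (x < y ∧ y < z) ∨ (y < z ∧ z < x) ∨ (z < x ∧ x < y)

/-- The orientation condition for an inversion triple with boxes `a`, `b`, `c`, where `b` is
immediately to the right of `a`. The boxes have the subscripts `a₃`, `b₁`, `c₂`; of two equal
entries the one with the larger subscript is considered to be larger.

In type A (`c` below `b`) the counter-clockwise order of the boxes is `a → c → b → a`; in type B
(`c` above `a`) the clockwise order of the boxes is `a → c → b → a`. So the same
condition describes the inversion triples of both types. -/
def IsInversion (a b c : Entry n) : Prop :=
  CyclicallyIncreasing (toLex (a, (3 : ℕ))) (toLex (c, (2 : ℕ))) (toLex (b, (1 : ℕ)))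

/-- There is an inversion triple of type A: `a = (r, j)`, `b = (r, j + 1)`, and `c = (s, j + 1)`
lies below `b`, in a row that is at most as long as row `r`. -/
def HasInversionA (σ : Equiv.Perm (Fin n)) (F : Filling α) : Prop :=
  ∃ (r s : Fin n) (j : Fin (α r)) (h : (j : ℕ) + 1 < α s + 1), r < s ∧ α s ≤ α r ∧
    IsInversion (augEntry σ F r j.castSucc) (augEntry σ F r j.succ)
      (augEntry σ F s ⟨(j : ℕ) + 1, h⟩)

/-- There is an inversion triple of type B: `a = (r, j)`, `b = (r, j + 1)`, and `c = (s, j)` lies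
above `a`, in a row that is strictly shorter than row `r`. -/
def HasInversionB (σ : Equiv.Perm (Fin n)) (F : Filling α) : Prop :=
  ∃ (r s : Fin n) (j : Fin (α r)) (h : (j : ℕ) < α s + 1), s < r ∧ α s < α r ∧
    IsInversion (augEntry σ F r j.castSucc) (augEntry σ F r j.succ)
      (augEntry σ F s ⟨(j : ℕ), h⟩)

/-- The number of boxes to the right of the box in row `r` and column `c`. -/
def leg (r : Fin n) (c : Fin (α r + 1)) : ℕ := α r - (c : ℕ)

/-- The major index: the sum of `leg u + 1` over all non-basement boxes `u` that are descents,
that is, whose entry is larger than the entry of the box immediately to the left. -/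
def maj (σ : Equiv.Perm (Fin n)) (F : Filling α) : ℕ :=
  ∑ r : Fin n, ∑ j : Fin (α r),
    if augEntry σ F r j.castSucc < augEntry σ F r j.succ then leg r j.succ + 1 else 0

/-- The multiset of all entries in column `c` (column `0` is the basement). -/
def columnSet (σ : Equiv.Perm (Fin n)) (F : Filling α) (c : ℕ) : Multiset (Entry n) :=
  (Finset.univ : Finset {r : Fin n // c < α r + 1}).val.map
    (fun r => augEntry σ F r.1 ⟨c, r.2⟩)

end

/-- The set of inversion-free fillings of shape `α` with big basement
`(∞_{σ 0}, …, ∞_{σ (n-1)})`. -/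
def InvFree {n : ℕ} (α : Fin n → ℕ) (σ : Equiv.Perm (Fin n)) : Set (Filling α) :=
  {F | ¬ HasInversionA σ F ∧ ¬ HasInversionB σ F}

end BigBasement

/-!
Read cyclically, "the triple `a`, `b`, `c` is not an inversion triple" says that `c` is not on the
open arc that leads upward from `a` to `b` (`Arc`). Of two rows, the longer one (the upper one, if
their lengths agree) dominates: only its steps `a → b` are constrained by the entries of the other
row, by those in the column of `b` if the longer row is above and by those in the column of `a` if
it is below (`Compat`). A filling is inversion-free iff every two of its rows are compatible.

If rows `i` and `j = i + 1` have equal length, the shape does not change, and interchanging the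
two basement entries affects neither inversion-freeness nor `maj`: the identity is the bijection.

If row `i` is longer, it moves below row `j`, with its basement entry, and the bijection
redistributes between these two rows the two entries of each column that they share; all other rows
are kept. With the longer row above, compatibility determines the distribution from left to right;
with the longer row below, from right to left, starting from the first column that the longer row
has to itself. The hypothesis `σ j < σ i` makes the basement column come out right. So the relation
`SwapRel` is the graph of a bijection, as soon as it is known to preserve inversion-freeness and
`maj`. Compare the two distributions on two consecutive columns with shared entries `{a, b}` and
`{x, y}`. If the pairs separate each other on the circle, both distributions join the same entries.
Otherwise the two possible matchings cover the same arcs and have equally many descents. Hence: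

* descents of the two rows together agree for each pair of consecutive columns (`descents_pair`),
  and the descents of the longer row, counted up to a column in which both distributions agree,
  agree because the two paths wind around the circle equally often (`winding_step`), so `maj` is
  preserved (`rowMaj_add_eq`);
* a third row dominated by both rows sees only the union of the arcs (`arc_or_arc_iff`), a third
  row dominating both rows sees only the column sets, and for a third row in between the longer and
  the shorter one, the entries of that row avoid the arc from the old to the new entry of the
  longer row, by induction along the columns (`compat_upper_iff`, `compat_lower_iff`).
-/

namespace BigBasement

/-- The ordered pairs `(a, b)` and `(a', b')` have the same underlying unordered pair. -/
def SamePair {β : Type*} (a b a' b' : β) : Prop := (a' = a ∧ b' = b) ∨ (a' = b ∧ b' = a)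

theorem SamePair.symm {β : Type*} {a b a' b' : β} (h : SamePair a b a' b') :
    SamePair a' b' a b := by
  grind [SamePair]

/-! ### Arcs on a cyclically ordered set -/

section Arc

variable {β : Type*} [LinearOrder β]

/-- `c` is on the open arc that leads upward from `a` to `b`, passing from the top of the order to
its bottom if `b ≤ a`. For `a = b` the arc is everything but `a`: this is the convention for equal
entries in inversion triples. -/
def Arc (a b c : β) : Prop := (a < b ∧ a < c ∧ c < b) ∨ (b ≤ a ∧ (a < c ∨ c < b))

/-- `c` is on the arc from `a` (excluded) to `b` (included). The arc is empty if `a = b`. -/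
def ArcR (a b c : β) : Prop := (a < b ∧ a < c ∧ c ≤ b) ∨ (b < a ∧ (a < c ∨ c ≤ b))

/-- `c` is on the arc from `a` (included) to `b` (excluded). The arc is empty if `a = b`. -/
def ArcL (a b c : β) : Prop := (a < b ∧ a ≤ c ∧ c < b) ∨ (b < a ∧ (a ≤ c ∨ c < b))

theorem isInversion_iff_arc {n : ℕ} (a b c : Entry n) : IsInversion a b c ↔ Arc a b c := by
  unfold IsInversion CyclicallyIncreasing Arc
  simp only [Prod.Lex.toLex_lt_toLex]
  norm_num
  grind

variable {a b x y a' b' x' y' k l z : β}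

theorem not_arc_swap_left (h : Arc a x b) : ¬ Arc b x a := by grind [Arc]

theorem not_arc_swap_right (h : Arc a x y) : ¬ Arc a y x := by grind [Arc]

/-! In the following lemmas, `a, b` are the entries of the longer and of the shorter row in some
column, and `x, y` those in the next column, when the longer row is above; `a', b'` and `x', y'` are
the entries after the exchange, when the longer row is below. In the lemmas named `_last`, the
shorter row ends in the first of the two columns. A third row has the entries `k` and `l` in the two
columns. -/

/-- The steps of the two rows together cover the same arcs before and after the exchange. -/
theorem arc_or_arc_iff (h : SamePair a b a' b') (h' : SamePair x y x' y')
    (hA : ¬ Arc a x y) (hB : ¬ Arc a' x' b') :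
    (Arc a x z ∨ Arc b y z) ↔ (Arc a' x' z ∨ Arc b' y' z) := by
  rcases h with ⟨rfl, rfl⟩ | ⟨rfl, rfl⟩ <;> rcases h' with ⟨rfl, rfl⟩ | ⟨rfl, rfl⟩ <;>
    grind [Arc]

/-- The two rows together have as many descents before as after the exchange. -/
theorem descents_pair (h : SamePair a b a' b') (h' : SamePair x y x' y')
    (hA : ¬ Arc a x y) (hB : ¬ Arc a' x' b') :
    (if a < x then 1 else 0) + (if b < y then 1 else 0) =
      (if a' < x' then 1 else 0) + (if b' < y' then 1 else 0) := by
  rcases h with ⟨rfl, rfl⟩ | ⟨rfl, rfl⟩ <;> rcases h' with ⟨rfl, rfl⟩ | ⟨rfl, rfl⟩ <;>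
    grind [Arc]

/-- The path of the longer row after the exchange is ahead of the path before by less than a full
turn, so it has lost one descent exactly if its present entry is the smaller one. This relation
passes from one column to the next. -/
theorem winding_step (h : SamePair a b a' b') (h' : SamePair x y x' y')
    (hA : ¬ Arc a x y) (hB : ¬ Arc a' x' b') :
    (if a' < a then 1 else 0) + (if a < x then 1 else 0) =
      (if a' < x' then 1 else 0) + (if x' < x then 1 else 0) := by
  rcases h with ⟨rfl, rfl⟩ | ⟨rfl, rfl⟩ <;> rcases h' with ⟨rfl, rfl⟩ | ⟨rfl, rfl⟩ <;>
    grind [Arc]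

theorem winding_last (h : SamePair a b a' b') (hB : ¬ Arc a' x b') :
    (if a' < a then 1 else 0) + (if a < x then 1 else 0) = (if a' < x then 1 else 0) := by
  rcases h with ⟨rfl, rfl⟩ | ⟨rfl, rfl⟩ <;> grind [Arc]

/-- A third row above, which dominates the shorter row and is dominated by the longer one. Its
entry stays off the arc from `a` to `a'`: this passes from a column to the one on its left, and
implies that compatibility is kept. -/
theorem above_forward (h : SamePair a b a' b') (h' : SamePair x y x' y')
    (hA : ¬ Arc a x y) (hB : ¬ Arc a' x' b') (hP : ¬ ArcR x x' l)
    (h1 : ¬ Arc a x k) (h2 : ¬ Arc k l y) :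
    ¬ ArcR a a' k ∧ ¬ Arc a' x' k ∧ ¬ Arc k l y' := by
  rcases h with ⟨rfl, rfl⟩ | ⟨rfl, rfl⟩ <;> rcases h' with ⟨rfl, rfl⟩ | ⟨rfl, rfl⟩ <;>
    grind [Arc, ArcR]

theorem above_forward_last (h : SamePair a b a' b')
    (hB : ¬ Arc a' x b') (h1 : ¬ Arc a x k) : ¬ ArcR a a' k ∧ ¬ Arc a' x k := by
  rcases h with ⟨rfl, rfl⟩ | ⟨rfl, rfl⟩ <;> grind [Arc, ArcR]

/-- The converse of `above_forward`: here the invariant passes from a column to the one on its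
right. -/
theorem above_backward (h : SamePair a b a' b') (h' : SamePair x y x' y')
    (hA : ¬ Arc a x y) (hB : ¬ Arc a' x' b') (hP : ¬ ArcR a a' k)
    (h1 : ¬ Arc a' x' k) (h2 : ¬ Arc k l y') :
    ¬ ArcR x x' l ∧ ¬ Arc a x k ∧ ¬ Arc k l y := by
  rcases h with ⟨rfl, rfl⟩ | ⟨rfl, rfl⟩ <;> rcases h' with ⟨rfl, rfl⟩ | ⟨rfl, rfl⟩ <;>
    grind [Arc, ArcR]

theorem above_backward_last (h : SamePair a b a' b')
    (hB : ¬ Arc a' x b') (hP : ¬ ArcR a a' k) (h1 : ¬ Arc a' x k) : ¬ Arc a x k := by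
  rcases h with ⟨rfl, rfl⟩ | ⟨rfl, rfl⟩ <;> grind [Arc, ArcR]

/-- The analogue of `above_forward` for a third row below the two rows. The arc that its entry
avoids now contains `a` and not `a'`. -/
theorem below_forward (h : SamePair a b a' b') (h' : SamePair x y x' y')
    (hA : ¬ Arc a x y) (hB : ¬ Arc a' x' b') (hP : ¬ ArcL x x' l)
    (h1 : ¬ Arc a x l) (h2 : ¬ Arc k l b) :
    ¬ ArcL a a' k ∧ ¬ Arc a' x' l ∧ ¬ Arc k l b' := by
  rcases h with ⟨rfl, rfl⟩ | ⟨rfl, rfl⟩ <;> rcases h' with ⟨rfl, rfl⟩ | ⟨rfl, rfl⟩ <;>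
    grind [Arc, ArcL]

theorem below_forward_last (h : SamePair a b a' b')
    (hB : ¬ Arc a' x b') (h1 : ¬ Arc a x l) (h2 : ¬ Arc k l b) :
    ¬ ArcL a a' k ∧ ¬ Arc a' x l ∧ ¬ Arc k l b' := by
  rcases h with ⟨rfl, rfl⟩ | ⟨rfl, rfl⟩ <;> grind [Arc, ArcL]

/-- The converse of `below_forward`, with the invariant passing to the right. -/
theorem below_backward (h : SamePair a b a' b') (h' : SamePair x y x' y')
    (hA : ¬ Arc a x y) (hB : ¬ Arc a' x' b') (hP : ¬ ArcL a a' k)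
    (h1 : ¬ Arc a' x' l) (h2 : ¬ Arc k l b') :
    ¬ ArcL x x' l ∧ ¬ Arc a x l ∧ ¬ Arc k l b := by
  rcases h with ⟨rfl, rfl⟩ | ⟨rfl, rfl⟩ <;> rcases h' with ⟨rfl, rfl⟩ | ⟨rfl, rfl⟩ <;>
    grind [Arc, ArcL]

theorem below_backward_last (h : SamePair a b a' b')
    (hB : ¬ Arc a' x b') (hP : ¬ ArcL a a' k)
    (h1 : ¬ Arc a' x l) (h2 : ¬ Arc k l b') : ¬ Arc a x l ∧ ¬ Arc k l b := by
  rcases h with ⟨rfl, rfl⟩ | ⟨rfl, rfl⟩ <;> grind [Arc, ArcL]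

end Arc

/-! ### Pairs of rows -/

section Rows

/-- The rows `a'`, `b'` arise from the longer row `a` and the row `b` of length `m` by exchanging
the entries in some of the columns `1, …, m`. Nothing is said about `b` and `b'` beyond
column `m`. -/
def RowPair {β : Type*} (m : ℕ) (a b a' b' : ℕ → β) : Prop :=
  (∀ c ≤ m, SamePair (a c) (b c) (a' c) (b' c)) ∧ a' 0 = a 0 ∧ ∀ c, m < c → a' c = a c

theorem RowPair.symm {β : Type*} {m : ℕ} {a b a' b' : ℕ → β}
    (h : RowPair m a b a' b') : RowPair m a' b' a b :=
  ⟨fun c hc => (h.1 c hc).symm, h.2.1.symm, fun c hc => (h.2.2 c hc).symm⟩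

variable {β : Type*} [LinearOrder β]

theorem samePair_unique_of_not_arc_left {a b x a' b' a'' b'' : β} (h' : SamePair a b a' b')
    (h'' : SamePair a b a'' b'') (hB' : ¬ Arc a' x b') (hB'' : ¬ Arc a'' x b'') :
    a' = a'' ∧ b' = b'' := by
  grind [Arc, SamePair]

theorem samePair_unique_of_not_arc_right {a x y x' y' x'' y'' : β} (h' : SamePair x y x' y')
    (h'' : SamePair x y x'' y'') (hA' : ¬ Arc a x' y') (hA'' : ¬ Arc a x'' y'') :
    x' = x'' ∧ y' = y'' := by
  grind [Arc, SamePair]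

/-- Rows `u` of length `p` and, below it, `v` of length `q` (columns `0, …, p` and `0, …, q`, the
basement included) form no inversion triple. -/
def Compat (p q : ℕ) (u v : ℕ → β) : Prop :=
  (q ≤ p → ∀ c < q, ¬ Arc (u c) (u (c + 1)) (v (c + 1))) ∧
    (p < q → ∀ c ≤ p, ¬ Arc (v c) (v (c + 1)) (u c))

variable {l m M : ℕ} {a b a' b' a'' b'' k : ℕ → β}

/-- The entries of two rows, the shorter one of length `m`, can be redistributed in the columns up
to `m` so that the rows are compatible with the longer row below. -/
theorem exists_compat_short_above (m : ℕ) (a b : ℕ → β) :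
    ∃ a' b' : ℕ → β, (∀ c ≤ m, SamePair (a c) (b c) (a' c) (b' c)) ∧
      (∀ c, m < c → a' c = a c) ∧ ∀ c ≤ m, ¬ Arc (a' c) (a' (c + 1)) (b' c) := by
  -- column `m` is settled first; the columns to its left follow by induction
  have key : ∀ m (a b : ℕ → β), ∃ u v : ℕ → β, (∀ c, SamePair (a c) (b c) (u c) (v c)) ∧
      (∀ c, c ≠ m → u c = a c ∧ v c = b c) ∧ ¬ Arc (u m) (u (m + 1)) (v m) := by
    intro m a b
    by_cases h : Arc (a m) (a (m + 1)) (b m)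
    · refine ⟨Function.update a m (b m), Function.update b m (a m), fun c => ?_, ?_, ?_⟩
      · rcases eq_or_ne c m with rfl | hc
        · simp [SamePair]
        · simp [SamePair, hc]
      · intro c hc
        simp [hc]
      · simpa using not_arc_swap_left h
    · exact ⟨a, b, fun c => Or.inl ⟨rfl, rfl⟩, fun c _ => ⟨rfl, rfl⟩, h⟩
  induction m generalizing a b with
  | zero =>
    obtain ⟨u, v, h1, h2, h3⟩ := key 0 a b
    refine ⟨u, v, fun c _ => h1 c, fun c hc => (h2 c (by omega)).1, fun c hc => ?_⟩
    obtain rfl : c = 0 := by omega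
    exact h3
  | succ m ih =>
    obtain ⟨u, v, h1, h2, h3⟩ := key (m + 1) a b
    obtain ⟨u', v', g1, g2, g3⟩ := ih u v
    refine ⟨u', Function.update v' (m + 1) (v (m + 1)), fun c hc => ?_, fun c hc => ?_,
      fun c hc => ?_⟩
    · rcases eq_or_ne c (m + 1) with rfl | hcm
      · simpa [g2 (m + 1) (by omega)] using h1 (m + 1)
      · have := g1 c (by omega)
        rw [(h2 c hcm).1, (h2 c hcm).2] at this
        simpa [hcm] using this
    · rw [g2 c (by omega), (h2 c (by omega)).1]
    · rcases eq_or_ne c (m + 1) with rfl | hcm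
      · simpa [g2 (m + 1) (by omega), g2 (m + 1 + 1) (by omega)] using h3
      · simpa [hcm] using g3 c (by omega)

/-- The entries of two rows, the shorter one of length `m`, can be redistributed in the columns up
to `m`, the basement excepted, so that the rows are compatible with the longer row above. -/
theorem exists_compat_long_above (m : ℕ) (a b : ℕ → β) :
    ∃ a' b' : ℕ → β, RowPair m a b a' b' ∧
      ∀ c < m, ¬ Arc (a' c) (a' (c + 1)) (b' (c + 1)) := by
  induction m with
  | zero => exact ⟨a, b, ⟨fun c _ => Or.inl ⟨rfl, rfl⟩, rfl, fun c _ => rfl⟩, by simp⟩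
  | succ m ih =>
    obtain ⟨u, v, ⟨h1, h2, h3⟩, h4⟩ := ih
    by_cases h : Arc (u m) (a (m + 1)) (b (m + 1))
    · refine ⟨Function.update u (m + 1) (b (m + 1)), Function.update v (m + 1) (a (m + 1)),
        ⟨fun c hc => ?_, by simpa using h2, fun c hc => ?_⟩, fun c hc => ?_⟩
      · rcases eq_or_ne c (m + 1) with rfl | hcm
        · simp [SamePair]
        · simpa [hcm] using h1 c (by omega)
      · rw [Function.update_of_ne (by omega), h3 c (by omega)]
      · rcases eq_or_ne c m with rfl | hcm
        · simpa using not_arc_swap_right h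
        · have e1 : c ≠ m + 1 := by omega
          simpa [hcm, e1] using h4 c (by omega)
    · refine ⟨Function.update u (m + 1) (a (m + 1)), Function.update v (m + 1) (b (m + 1)),
        ⟨fun c hc => ?_, by simpa using h2, fun c hc => ?_⟩, fun c hc => ?_⟩
      · rcases eq_or_ne c (m + 1) with rfl | hcm
        · simp [SamePair]
        · simpa [hcm] using h1 c (by omega)
      · rw [Function.update_of_ne (by omega), h3 c (by omega)]
      · rcases eq_or_ne c m with rfl | hcm
        · simpa using h
        · have e1 : c ≠ m + 1 := by omega
          simpa [hcm, e1] using h4 c (by omega)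

theorem eq_of_compat_short_above (h' : RowPair m a b a' b') (h'' : RowPair m a b a'' b'')
    (hB' : ∀ c ≤ m, ¬ Arc (a' c) (a' (c + 1)) (b' c))
    (hB'' : ∀ c ≤ m, ¬ Arc (a'' c) (a'' (c + 1)) (b'' c)) :
    ∀ c ≤ m, a' c = a'' c ∧ b' c = b'' c := by
  have step : ∀ c ≤ m, a' (c + 1) = a'' (c + 1) → a' c = a'' c ∧ b' c = b'' c := by
    intro c hc hx
    have e := hB'' c hc
    rw [← hx] at e
    exact samePair_unique_of_not_arc_left (h'.1 c hc) (h''.1 c hc) (hB' c hc) e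
  intro c hc
  induction hc using Nat.decreasingInduction with
  | self => exact step m le_rfl (by rw [h'.2.2 _ (by omega), h''.2.2 _ (by omega)])
  | of_succ c hc ih => exact step c (by omega) ih.1

theorem eq_of_compat_long_above
    (h' : RowPair m a b a' b') (h'' : RowPair m a b a'' b'')
    (hA' : ∀ c < m, ¬ Arc (a' c) (a' (c + 1)) (b' (c + 1)))
    (hA'' : ∀ c < m, ¬ Arc (a'' c) (a'' (c + 1)) (b'' (c + 1))) :
    ∀ c ≤ m, a' c = a'' c ∧ b' c = b'' c := by
  intro c hc
  induction c with
  | zero =>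
    have e1 := h'.1 0 hc
    have e2 := h''.1 0 hc
    have e3 := h'.2.1
    have e4 := h''.2.1
    grind [SamePair]
  | succ c ih =>
    have e := hA'' c (by omega)
    rw [← (ih (by omega)).1] at e
    exact samePair_unique_of_not_arc_right (h'.1 _ hc) (h''.1 _ hc) (hA' c (by omega)) e

/-- Compatibility with a third row `k` of length `M` above the two rows is not affected by the
exchange. -/
theorem compat_upper_iff (hml : m < l) (h : RowPair m a b a' b')
    (hA : ∀ c < m, ¬ Arc (a c) (a (c + 1)) (b (c + 1)))
    (hB : ∀ c ≤ m, ¬ Arc (a' c) (a' (c + 1)) (b' c)) :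
    (Compat M l k a ∧ Compat M m k b) ↔ (Compat M l k a' ∧ Compat M m k b') := by
  obtain ⟨h1, h2, h3⟩ := h
  rcases le_or_gt l M with hM | hM
  · -- the third row dominates both rows, which enter symmetrically
    simp only [Compat, hM, not_lt_of_ge hM, hml.le.trans hM, not_lt_of_ge (hml.le.trans hM),
      forall_true_left, false_imp_iff, and_true]
    have aux : ∀ c, (c < m → ((¬ Arc (k c) (k (c + 1)) (a (c + 1)) ∧
        ¬ Arc (k c) (k (c + 1)) (b (c + 1))) ↔ (¬ Arc (k c) (k (c + 1)) (a' (c + 1)) ∧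
        ¬ Arc (k c) (k (c + 1)) (b' (c + 1))))) ∧ (m ≤ c → a' (c + 1) = a (c + 1)) := by
      intro c
      refine ⟨fun hc => ?_, fun hc => h3 _ (by omega)⟩
      rcases h1 (c + 1) (by omega) with ⟨e1, e2⟩ | ⟨e1, e2⟩ <;> rw [e1, e2]
      tauto
    grind
  rcases le_or_gt m M with hm | hm
  · -- the third row dominates the shorter row and is dominated by the longer one
    simp only [Compat, hM, not_le_of_gt hM, hm, not_lt_of_ge hm, forall_true_left,
      false_imp_iff, and_true, true_and]
    have e3 : a' (m + 1) = a (m + 1) := h3 _ (by omega)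
    constructor
    · rintro ⟨g1, g2⟩
      -- the invariant starts at the end of the shorter row, since `a` is unchanged beyond it
      have hP : ∀ c ≤ m, ¬ ArcR (a c) (a' c) (k c) := by
        intro c hc
        induction hc using Nat.decreasingInduction with
        | self =>
          exact (above_forward_last (h1 m le_rfl) (e3 ▸ hB m le_rfl) (g1 m hm)).1
        | of_succ c hc ih =>
          exact (above_forward (h1 c (by omega)) (h1 (c + 1) hc) (hA c hc) (hB c (by omega)) ih
            (g1 c (by omega)) (g2 c hc)).1
      have step := fun c (hc : c < m) => above_forward (h1 c hc.le) (h1 (c + 1) hc) (hA c hc)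
        (hB c hc.le) (hP (c + 1) hc) (g1 c (by omega)) (g2 c hc)
      refine ⟨fun c hc => ?_, fun c hc => (step c hc).2.2⟩
      rcases lt_trichotomy c m with hcm | rfl | hcm
      · exact (step c hcm).2.1
      · exact e3 ▸ (above_forward_last (h1 c le_rfl) (e3 ▸ hB c le_rfl) (g1 c hm)).2
      · rw [h3 c hcm, h3 (c + 1) (by omega)]
        exact g1 c hc
    · rintro ⟨g1, g2⟩
      -- the invariant starts at the basement, where `a` is unchanged
      have hP : ∀ c ≤ m, ¬ ArcR (a c) (a' c) (k c) := by
        intro c hc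
        induction c with
        | zero => rw [h2]; simp [ArcR]
        | succ c ih =>
          exact (above_backward (h1 c (by omega)) (h1 (c + 1) hc) (hA c hc) (hB c (by omega))
            (ih (by omega)) (g1 c (by omega)) (g2 c hc)).1
      have step := fun c (hc : c < m) => above_backward (h1 c hc.le) (h1 (c + 1) hc) (hA c hc)
        (hB c hc.le) (hP c hc.le) (g1 c (by omega)) (g2 c hc)
      refine ⟨fun c hc => ?_, fun c hc => (step c hc).2.2⟩
      rcases lt_trichotomy c m with hcm | rfl | hcm
      · exact (step c hcm).2.1
      · exact above_backward_last (h1 c le_rfl) (e3 ▸ hB c le_rfl) (hP c le_rfl)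
          (e3 ▸ g1 c hm)
      · rw [← h3 c hcm, ← h3 (c + 1) (by omega)]
        exact g1 c hc
  · -- the third row is dominated by both rows
    simp only [Compat, hM, not_le_of_gt hM, hm, not_le_of_gt hm, forall_true_left,
      false_imp_iff, true_and]
    have aux := fun c (hc : c ≤ M) => arc_or_arc_iff (z := k c) (h1 c (by omega))
      (h1 (c + 1) (by omega)) (hA c (by omega)) (hB c (by omega))
    grind

/-- Compatibility with a third row `k` of length `M` below the two rows is not affected by the
exchange. -/
theorem compat_lower_iff (hml : m < l) (h : RowPair m a b a' b')
    (hA : ∀ c < m, ¬ Arc (a c) (a (c + 1)) (b (c + 1)))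
    (hB : ∀ c ≤ m, ¬ Arc (a' c) (a' (c + 1)) (b' c)) :
    (Compat l M a k ∧ Compat m M b k) ↔ (Compat l M a' k ∧ Compat m M b' k) := by
  obtain ⟨h1, h2, h3⟩ := h
  rcases lt_or_ge l M with hM | hM
  · -- the third row dominates both rows, which enter symmetrically
    simp only [Compat, hM, not_le_of_gt hM, hml.trans hM, not_le_of_gt (hml.trans hM),
      forall_true_left, false_imp_iff, true_and]
    have aux : ∀ c, (c ≤ m → ((¬ Arc (k c) (k (c + 1)) (a c) ∧
        ¬ Arc (k c) (k (c + 1)) (b c)) ↔ (¬ Arc (k c) (k (c + 1)) (a' c) ∧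
        ¬ Arc (k c) (k (c + 1)) (b' c)))) ∧ (m < c → a' c = a c) := by
      intro c
      refine ⟨fun hc => ?_, fun hc => h3 _ (by omega)⟩
      rcases h1 c hc with ⟨e1, e2⟩ | ⟨e1, e2⟩ <;> rw [e1, e2]
      tauto
    grind
  rcases lt_or_ge m M with hm | hm
  · -- the third row dominates the shorter row and is dominated by the longer one
    simp only [Compat, hM, not_lt_of_ge hM, hm, not_le_of_gt hm, forall_true_left,
      false_imp_iff, and_true, true_and]
    have e3 : a' (m + 1) = a (m + 1) := h3 _ (by omega)
    constructor
    · rintro ⟨g1, g2⟩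
      have hlast := below_forward_last (h1 m le_rfl) (e3 ▸ hB m le_rfl) (g1 m hm) (g2 m le_rfl)
      -- the invariant starts at the end of the shorter row, since `a` is unchanged beyond it
      have hP : ∀ c ≤ m, ¬ ArcL (a c) (a' c) (k c) := by
        intro c hc
        induction hc using Nat.decreasingInduction with
        | self => exact hlast.1
        | of_succ c hc ih =>
          exact (below_forward (h1 c (by omega)) (h1 (c + 1) hc) (hA c hc) (hB c (by omega)) ih
            (g1 c (by omega)) (g2 c hc.le)).1
      have step := fun c (hc : c < m) => below_forward (h1 c hc.le) (h1 (c + 1) hc) (hA c hc)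
        (hB c hc.le) (hP (c + 1) hc) (g1 c (by omega)) (g2 c hc.le)
      refine ⟨fun c hc => ?_, fun c hc => ?_⟩
      · rcases lt_trichotomy c m with hcm | rfl | hcm
        · exact (step c hcm).2.1
        · exact e3 ▸ hlast.2.1
        · rw [h3 c hcm, h3 (c + 1) (by omega)]
          exact g1 c hc
      · rcases hc.lt_or_eq with hcm | rfl
        · exact (step c hcm).2.2
        · exact hlast.2.2
    · rintro ⟨g1, g2⟩
      -- the invariant starts at the basement, where `a` is unchanged
      have hP : ∀ c ≤ m, ¬ ArcL (a c) (a' c) (k c) := by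
        intro c hc
        induction c with
        | zero => rw [h2]; simp [ArcL]
        | succ c ih =>
          exact (below_backward (h1 c (by omega)) (h1 (c + 1) hc) (hA c hc) (hB c (by omega))
            (ih (by omega)) (g1 c (by omega)) (g2 c (by omega))).1
      have step := fun c (hc : c < m) => below_backward (h1 c hc.le) (h1 (c + 1) hc) (hA c hc)
        (hB c hc.le) (hP c hc.le) (g1 c (by omega)) (g2 c hc.le)
      have hlast := below_backward_last (h1 m le_rfl) (e3 ▸ hB m le_rfl) (hP m le_rfl)
        (e3 ▸ g1 m hm) (g2 m le_rfl)
      refine ⟨fun c hc => ?_, fun c hc => ?_⟩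
      · rcases lt_trichotomy c m with hcm | rfl | hcm
        · exact (step c hcm).2.1
        · exact hlast.1
        · rw [← h3 c hcm, ← h3 (c + 1) (by omega)]
          exact g1 c hc
      · rcases hc.lt_or_eq with hcm | rfl
        · exact (step c hcm).2.2
        · exact hlast.2
  · -- the third row is dominated by both rows
    simp only [Compat, hM, not_lt_of_ge hM, hm, not_lt_of_ge hm, forall_true_left,
      false_imp_iff, and_true]
    have aux := fun c (hc : c < M) => arc_or_arc_iff (z := k (c + 1)) (h1 c (by omega))
      (h1 (c + 1) (by omega)) (hA c (by omega)) (hB c (by omega))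
    grind

/-- The contribution of a row of length `l` to the major index: a descent from column `c` to
column `c + 1` contributes its leg plus one, that is `l - c`. -/
def rowMaj (l : ℕ) (a : ℕ → β) : ℕ :=
  ∑ c ∈ Finset.range l, if a c < a (c + 1) then l - c else 0

/-- Up to a column that the shorter row reaches, the longer row has lost at most one descent, and
exactly one if its present entry has become smaller. -/
theorem descents_add (h : RowPair m a b a' b')
    (hA : ∀ c < m, ¬ Arc (a c) (a (c + 1)) (b (c + 1)))
    (hB : ∀ c ≤ m, ¬ Arc (a' c) (a' (c + 1)) (b' c)) :
    ∀ c ≤ m, (∑ t ∈ Finset.range c, if a t < a (t + 1) then 1 else 0) =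
      (∑ t ∈ Finset.range c, if a' t < a' (t + 1) then 1 else 0) +
        (if a' c < a c then 1 else 0) := by
  intro c hc
  induction c with
  | zero => simp [h.2.1]
  | succ c ih =>
    rw [Finset.sum_range_succ, Finset.sum_range_succ, ih (by omega)]
    have := winding_step (h.1 c (by omega)) (h.1 (c + 1) hc) (hA c hc) (hB c (by omega))
    omega

/-- A row of length `m + 1 + d` is cut at column `m + 1`: each descent up to there is counted
`d + 1` times, and `m - c` times more, as it would be in a row of length `m`. -/
theorem rowMaj_split (d : ℕ) (a : ℕ → β) :
    rowMaj (m + 1 + d) a =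
      (∑ c ∈ Finset.range m, if a c < a (c + 1) then m - c else 0) +
      (d + 1) * (∑ c ∈ Finset.range (m + 1), if a c < a (c + 1) then 1 else 0) +
      ∑ c ∈ Finset.range d, if a (m + 1 + c) < a (m + 1 + c + 1) then d - c else 0 := by
  rw [rowMaj, Finset.sum_range_add]
  congr 1
  · rw [Finset.mul_sum, Finset.sum_range_succ, Finset.sum_range_succ _ m, ← add_assoc,
      ← Finset.sum_add_distrib]
    congr 1
    · refine Finset.sum_congr rfl fun c hc => ?_
      have := Finset.mem_range.1 hc
      split_ifs <;> omega
    · split_ifs <;> omega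
  · refine Finset.sum_congr rfl fun c hc => ?_
    split_ifs <;> omega

/-- The exchange preserves the contribution of the two rows to the major index. -/
theorem rowMaj_add_eq (hml : m < l) (h : RowPair m a b a' b')
    (hA : ∀ c < m, ¬ Arc (a c) (a (c + 1)) (b (c + 1)))
    (hB : ∀ c ≤ m, ¬ Arc (a' c) (a' (c + 1)) (b' c)) :
    rowMaj l a' + rowMaj m b' = rowMaj l a + rowMaj m b := by
  obtain ⟨d, rfl⟩ : ∃ d, l = m + 1 + d := ⟨l - (m + 1), by omega⟩
  have e3 : a' (m + 1) = a (m + 1) := h.2.2 _ (by omega)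
  have hdes : (∑ c ∈ Finset.range (m + 1), if a' c < a' (c + 1) then 1 else 0) =
      ∑ c ∈ Finset.range (m + 1), if a c < a (c + 1) then 1 else 0 := by
    rw [Finset.sum_range_succ, Finset.sum_range_succ, descents_add h hA hB m le_rfl, e3]
    have := winding_last (h.1 m le_rfl) (e3 ▸ hB m le_rfl)
    omega
  have htail : (∑ c ∈ Finset.range d,
        if a' (m + 1 + c) < a' (m + 1 + c + 1) then d - c else 0) =
      ∑ c ∈ Finset.range d, if a (m + 1 + c) < a (m + 1 + c + 1) then d - c else 0 :=
    Finset.sum_congr rfl fun c _ => by rw [h.2.2 _ (by omega), h.2.2 _ (by omega)]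
  have hhead : (∑ c ∈ Finset.range m, if a' c < a' (c + 1) then m - c else 0) + rowMaj m b' =
      (∑ c ∈ Finset.range m, if a c < a (c + 1) then m - c else 0) + rowMaj m b := by
    rw [rowMaj, rowMaj, ← Finset.sum_add_distrib, ← Finset.sum_add_distrib]
    refine Finset.sum_congr rfl fun c hc => ?_
    have hc' := Finset.mem_range.1 hc
    have := descents_pair (h.1 c hc'.le) (h.1 (c + 1) hc') (hA c hc') (hB c hc'.le)
    have := congrArg (fun t => (m - c) * t) this
    simp only [mul_add, mul_ite, mul_one, mul_zero] at this
    exact this.symm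
  rw [rowMaj_split, rowMaj_split, hdes, htail]
  omega

end Rows

/-! ### Fillings as families of rows -/

section Fillings

variable {n : ℕ} {α : Fin n → ℕ} {σ : Equiv.Perm (Fin n)}

/-- Row `r` of the augmented filling as a function on all columns, with the arbitrary value `0`
beyond the end of the row. -/
def rowEntry (σ : Equiv.Perm (Fin n)) (F : Filling α) (r : Fin n) : ℕ → Entry n
  | 0 => Entry.inf (σ r)
  | c + 1 => if h : c < α r then Entry.fin (F r ⟨c, h⟩) else Entry.fin 0

theorem rowEntry_zero (F : Filling α) (r : Fin n) : rowEntry σ F r 0 = Entry.inf (σ r) := rfl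

theorem rowEntry_of_lt (F : Filling α) {r : Fin n} {c : ℕ} (h : α r < c) :
    rowEntry σ F r c = Entry.fin 0 := by
  cases c with
  | zero => omega
  | succ c => rw [rowEntry, dif_neg (by omega)]

theorem exists_rowEntry_succ (F : Filling α) (r : Fin n) (c : ℕ) :
    ∃ x, rowEntry σ F r (c + 1) = Entry.fin x := by
  rw [rowEntry]
  split_ifs <;> exact ⟨_, rfl⟩

theorem Entry.fin_injective : Function.Injective (Entry.fin : ℕ → Entry n) :=
  fun _ _ h => Sum.inl_injective (toLex.injective h)

theorem Entry.fin_lt_inf (k : ℕ) (p : Fin n) : Entry.fin k < Entry.inf p :=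
  Sum.Lex.inl_lt_inr k p

theorem Entry.inf_lt_inf {p q : Fin n} : Entry.inf p < Entry.inf q ↔ p < q :=
  Sum.Lex.inr_lt_inr_iff

theorem augEntry_eq_rowEntry (F : Filling α) (r : Fin n) (c : Fin (α r + 1)) :
    augEntry σ F r c = rowEntry σ F r c := by
  induction c using Fin.cases with
  | zero => rfl
  | succ c => simp [augEntry, rowEntry]

theorem exists_filling (σ : Equiv.Perm (Fin n)) (E : Fin n → ℕ → Entry n)
    (h0 : ∀ r, E r 0 = Entry.inf (σ r)) (h : ∀ r, ∀ c < α r, ∃ x, E r (c + 1) = Entry.fin x) :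
    ∃ F : Filling α, ∀ r, ∀ c ≤ α r, rowEntry σ F r c = E r c := by
  choose x hx using h
  refine ⟨fun r c => x r c c.2, fun r c hc => ?_⟩
  cases c with
  | zero => rw [rowEntry_zero, h0]
  | succ c => rw [rowEntry, dif_pos (by omega), hx]

theorem filling_ext {F G : Filling α}
    (h : ∀ r, ∀ c < α r, rowEntry σ F r (c + 1) = rowEntry σ G r (c + 1)) : F = G := by
  funext r c
  have := h r c c.2
  simp only [rowEntry, c.2, dif_pos] at this
  exact Entry.fin_injective this

theorem mem_invFree_iff (F : Filling α) :
    F ∈ InvFree α σ ↔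
      ∀ r s, r < s → Compat (α r) (α s) (rowEntry σ F r) (rowEntry σ F s) := by
  simp only [InvFree, Set.mem_ofPred_eq, HasInversionA, HasInversionB, isInversion_iff_arc,
    augEntry_eq_rowEntry, Compat]
  simp only [Fin.val_castSucc, Fin.val_succ]
  constructor
  · rintro ⟨hA, hB⟩ r s hrs
    exact ⟨fun h c hc hi => hA ⟨r, s, ⟨c, by omega⟩, by simpa using hc, hrs, h, hi⟩,
      fun h c hc hi => hB ⟨s, r, ⟨c, by omega⟩, by simpa [Nat.lt_succ_iff] using hc, hrs, h, hi⟩⟩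
  · intro h
    refine ⟨?_, ?_⟩
    · rintro ⟨r, s, c, hc, hrs, hle, hi⟩
      exact (h r s hrs).1 hle c (by omega) hi
    · rintro ⟨r, s, c, hc, hrs, hle, hi⟩
      exact (h s r hrs).2 hle c (by omega) hi

theorem maj_eq_sum_rowMaj (F : Filling α) : maj σ F = ∑ r, rowMaj (α r) (rowEntry σ F r) := by
  refine Finset.sum_congr rfl fun r _ => ?_
  rw [rowMaj, ← Fin.sum_univ_eq_sum_range
    (fun c => if rowEntry σ F r c < rowEntry σ F r (c + 1) then α r - c else 0)]
  refine Finset.sum_congr rfl fun c _ => ?_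
  simp only [augEntry_eq_rowEntry, Fin.val_castSucc, Fin.val_succ, leg]
  have := c.2
  congr 1
  omega

theorem columnSet_eq_sum (F : Filling α) (c : ℕ) :
    columnSet σ F c = ∑ r, if c ≤ α r then {rowEntry σ F r c} else 0 := by
  rw [← Finset.sum_filter, Finset.sum_subtype (p := fun r => c < α r + 1) _
    (by simp), columnSet, ← Multiset.sum_map_singleton (Multiset.map _ _),
    Multiset.map_map]
  simp only [augEntry_eq_rowEntry]
  rfl

theorem sum_eq_add_add_sum {M : Type*} [AddCommMonoid M] {i j : Fin n} (hij : i ≠ j)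
    (f : Fin n → M) : ∑ r, f r = (f i + f j) + ∑ r ∈ ({i, j} : Finset (Fin n))ᶜ, f r := by
  rw [← Finset.sum_add_sum_compl {i, j}, Finset.sum_pair hij]

/-! ### Rows of equal length -/

theorem arc_inf_fin_fin {p : Fin n} {x y : ℕ} :
    Arc (Entry.inf p : Entry n) (Entry.fin x) (Entry.fin y) ↔
      Entry.fin y < (Entry.fin x : Entry n) := by
  have h1 := Entry.fin_lt_inf x p
  have h2 := Entry.fin_lt_inf y p
  simp [Arc, h1.le, h1.not_gt, h2.not_gt]

theorem arc_inf_fin_inf {p q : Fin n} {x : ℕ} :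
    Arc (Entry.inf p : Entry n) (Entry.fin x) (Entry.inf q) ↔ p < q := by
  have h1 := Entry.fin_lt_inf x p
  have h2 := Entry.fin_lt_inf x q
  simp [Arc, h1.le, h1.not_gt, h2.not_gt, Entry.inf_lt_inf]

theorem swap_lt_swap_iff {i j : Fin n} (hij : (i : ℕ) + 1 = j) {r s : Fin n}
    (h : ¬ (r = i ∧ s = j)) (h' : ¬ (r = j ∧ s = i)) :
    Equiv.swap i j r < Equiv.swap i j s ↔ r < s := by
  simp only [Equiv.swap_apply_def, Fin.lt_def, Fin.ext_iff] at *
  grind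

/-- The basement matters only for pairs of rows `r < s` with `α r < α s`, which must satisfy
`σ r < σ s`. If `α i = α j`, the swap of `i` and `j` permutes these pairs. -/
theorem mem_invFree_mul_swap {i j : Fin n} (hij : (i : ℕ) + 1 = j) (hα : α i = α j)
    {F : Filling α} (hF : F ∈ InvFree α σ) : F ∈ InvFree α (σ * Equiv.swap i j) := by
  rw [mem_invFree_iff] at hF ⊢
  have hsw : ∀ r, α (Equiv.swap i j r) = α r := by
    intro r
    rw [Equiv.swap_apply_def]
    split_ifs with h1 h2 <;> simp_all
  intro r s hrs
  refine ⟨fun h c hc => ?_, fun h c hc => ?_⟩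
  · have := (hF r s hrs).1 h c hc
    cases c with
    | succ c => exact this
    | zero =>
      obtain ⟨x, hx⟩ := exists_rowEntry_succ (σ := σ) F r 0
      obtain ⟨y, hy⟩ := exists_rowEntry_succ (σ := σ) F s 0
      rw [rowEntry_zero, hx, hy, arc_inf_fin_fin] at this
      change ¬ Arc (Entry.inf _) (rowEntry σ F r (0 + 1)) (rowEntry σ F s (0 + 1))
      rwa [hx, hy, arc_inf_fin_fin]
  · cases c with
    | succ c => exact (hF r s hrs).2 h (c + 1) hc
    | zero =>
      have hlt : Equiv.swap i j r < Equiv.swap i j s :=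
        (swap_lt_swap_iff hij (by rintro ⟨rfl, rfl⟩; omega) (by rintro ⟨rfl, rfl⟩; omega)).2 hrs
      have := (hF _ _ hlt).2 (by rwa [hsw, hsw]) 0 (Nat.zero_le _)
      obtain ⟨x, hx⟩ := exists_rowEntry_succ (σ := σ) F (Equiv.swap i j s) 0
      obtain ⟨y, hy⟩ := exists_rowEntry_succ (σ := σ) F s 0
      rw [rowEntry_zero, rowEntry_zero, hx, arc_inf_fin_inf] at this
      change ¬ Arc (Entry.inf _) (rowEntry σ F s (0 + 1)) (Entry.inf _)
      rw [hy, arc_inf_fin_inf]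
      exact this

theorem rowMaj_rowEntry_congr (τ : Equiv.Perm (Fin n)) (F : Filling α) (r : Fin n) :
    rowMaj (α r) (rowEntry τ F r) = rowMaj (α r) (rowEntry σ F r) := by
  refine Finset.sum_congr rfl fun c _ => ?_
  cases c with
  | succ c => rfl
  | zero =>
    obtain ⟨x, hx⟩ := exists_rowEntry_succ (σ := σ) F r 0
    have hy : rowEntry τ F r (0 + 1) = Entry.fin x := hx
    rw [hx, hy, rowEntry_zero, rowEntry_zero, if_neg (Entry.fin_lt_inf _ _).not_gt,
      if_neg (Entry.fin_lt_inf _ _).not_gt]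

theorem columnSet_mul_perm (τ : Equiv.Perm (Fin n)) (F : Filling α) (c : ℕ) :
    columnSet (σ * τ) F c = columnSet σ F c := by
  rw [columnSet_eq_sum, columnSet_eq_sum]
  cases c with
  | succ c => rfl
  | zero =>
    simp only [Nat.zero_le, if_true, rowEntry_zero, Equiv.Perm.mul_apply]
    exact Equiv.sum_comp τ (fun r => ({Entry.inf (σ r)} : Multiset (Entry n)))

theorem exists_equiv_of_eq {i j : Fin n} (hij : (i : ℕ) + 1 = j) (hα : α i = α j)
    {α' : Fin n → ℕ} (hα' : α' = α) :
    ∃ φ : InvFree α σ ≃ InvFree α' (σ * Equiv.swap i j), ∀ F : InvFree α σ,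
      (∀ c, columnSet (σ * Equiv.swap i j) (φ F).1 c = columnSet σ F.1 c) ∧
        maj (σ * Equiv.swap i j) (φ F).1 = maj σ F.1 := by
  subst hα'
  have hset : InvFree α' σ = InvFree α' (σ * Equiv.swap i j) := by
    refine Set.Subset.antisymm (fun F hF => mem_invFree_mul_swap hij hα hF) fun F hF => ?_
    have := mem_invFree_mul_swap hij hα hF
    rwa [mul_assoc, Equiv.swap_mul_self, mul_one] at this
  refine ⟨Equiv.setCongr hset, fun F => ⟨fun c => columnSet_mul_perm _ _ c, ?_⟩⟩
  rw [maj_eq_sum_rowMaj, maj_eq_sum_rowMaj]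
  exact Finset.sum_congr rfl fun r _ => rowMaj_rowEntry_congr _ _ r

/-! ### Rows of distinct lengths -/

/-- The rows `E' r` replace the rows `E r`, with rows `i` and `j` interchanged in position. Rows are
indexed by their old positions throughout, so that row `r` keeps its length `α r`; its new position
is `Equiv.swap i j r`. -/
theorem forall_compat_iff {i j : Fin n} (hij : (i : ℕ) + 1 = j) (hα : α j < α i)
    {E E' : Fin n → ℕ → Entry n} (hE : ∀ r, r ≠ i → r ≠ j → E' r = E r)
    (hp : RowPair (α j) (E i) (E j) (E' i) (E' j))
    (hA : Compat (α i) (α j) (E i) (E j)) (hB : Compat (α j) (α i) (E' j) (E' i)) :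
    (∀ r s, r < s → Compat (α r) (α s) (E r) (E s)) ↔
      ∀ r s, Equiv.swap i j r < Equiv.swap i j s → Compat (α r) (α s) (E' r) (E' s) := by
  have hup := fun k M => compat_upper_iff (k := k) (M := M) hα hp (hA.1 hα.le) (hB.2 hα)
  have hlo := fun k M => compat_lower_iff (k := k) (M := M) hα hp (hA.1 hα.le) (hB.2 hα)
  have hlt : i < j := by simp only [Fin.lt_def]; omega
  have hi : ∀ r, r ≠ i → r ≠ j → (r < i ↔ r < j) := by
    intro r h1 h2
    simp only [Fin.lt_def, ne_eq, Fin.ext_iff] at *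
    omega
  have hj : ∀ r, r ≠ i → r ≠ j → (i < r ↔ j < r) := by
    intro r h1 h2
    simp only [Fin.lt_def, ne_eq, Fin.ext_iff] at *
    omega
  have hsw : (∀ r s, Equiv.swap i j r < Equiv.swap i j s →
      Compat (α r) (α s) (E' r) (E' s)) ↔
      ∀ r s, r < s → ¬ (r = i ∧ s = j) → Compat (α r) (α s) (E' r) (E' s) := by
    constructor
    · intro h r s hrs h1
      exact h r s ((swap_lt_swap_iff hij h1 (by rintro ⟨rfl, rfl⟩; exact hrs.not_gt hlt)).2 hrs)
    · intro h r s hrs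
      by_cases h2 : r = j ∧ s = i
      · rw [h2.1, h2.2]
        exact hB
      · have h1 : ¬ (r = i ∧ s = j) := by
          rintro ⟨rfl, rfl⟩
          rw [Equiv.swap_apply_left, Equiv.swap_apply_right] at hrs
          exact hrs.not_gt hlt
        exact h r s ((swap_lt_swap_iff hij h1 h2).1 hrs) h1
  rw [hsw]
  constructor
  · intro h r s hrs h1
    by_cases hri : r = i <;> by_cases hrj : r = j <;> by_cases hsi : s = i <;>
      by_cases hsj : s = j <;> grind
  · intro h r s hrs
    by_cases hri : r = i <;> by_cases hrj : r = j <;> by_cases hsi : s = i <;>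
      by_cases hsj : s = j <;> grind

/-- `G` arises from `F` by interchanging rows `i` and `j`, `j` being the shorter one, and by
exchanging the entries of these two rows in some of the non-basement columns that they share. -/
def SwapRel (σ : Equiv.Perm (Fin n)) (i j : Fin n) (F : Filling α)
    (G : Filling fun r => α (Equiv.swap i j r)) : Prop :=
  (∀ r, r ≠ i → r ≠ j → ∀ c,
      rowEntry (σ * Equiv.swap i j) G (Equiv.swap i j r) c = rowEntry σ F r c) ∧
    RowPair (α j) (rowEntry σ F i) (rowEntry σ F j)
      (rowEntry (σ * Equiv.swap i j) G j) (rowEntry (σ * Equiv.swap i j) G i)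

variable {i j : Fin n} {F F' : Filling α} {G G' : Filling fun r => α (Equiv.swap i j r)}

/-- Inversion-freeness of `G`, with its rows indexed by their positions before the interchange. -/
theorem mem_invFree_swap_iff :
    G ∈ InvFree (fun r => α (Equiv.swap i j r)) (σ * Equiv.swap i j) ↔
      ∀ r s, Equiv.swap i j r < Equiv.swap i j s → Compat (α r) (α s)
        (rowEntry (σ * Equiv.swap i j) G (Equiv.swap i j r))
        (rowEntry (σ * Equiv.swap i j) G (Equiv.swap i j s)) := by
  rw [mem_invFree_iff]
  constructor
  · intro h r s hrs
    simpa using h _ _ hrs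
  · intro h r s hrs
    have := h (Equiv.swap i j r) (Equiv.swap i j s)
    simp only [Equiv.swap_apply_self] at this
    exact this hrs

theorem compat_of_mem (hij : (i : ℕ) + 1 = j) (hF : F ∈ InvFree α σ) :
    Compat (α i) (α j) (rowEntry σ F i) (rowEntry σ F j) :=
  (mem_invFree_iff F).1 hF i j (by simp only [Fin.lt_def]; omega)

theorem compat_of_mem_swap (hij : (i : ℕ) + 1 = j)
    (hG : G ∈ InvFree (fun r => α (Equiv.swap i j r)) (σ * Equiv.swap i j)) :
    Compat (α j) (α i) (rowEntry (σ * Equiv.swap i j) G i)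
      (rowEntry (σ * Equiv.swap i j) G j) := by
  have := mem_invFree_swap_iff.1 hG j i
  simp only [Equiv.swap_apply_left, Equiv.swap_apply_right] at this
  exact this (by simp only [Fin.lt_def]; omega)

theorem mem_invFree_iff_of_swapRel (hij : (i : ℕ) + 1 = j) (hα : α j < α i)
    (h : SwapRel σ i j F G) (hA : Compat (α i) (α j) (rowEntry σ F i) (rowEntry σ F j))
    (hB : Compat (α j) (α i) (rowEntry (σ * Equiv.swap i j) G i)
      (rowEntry (σ * Equiv.swap i j) G j)) :
    F ∈ InvFree α σ ↔
      G ∈ InvFree (fun r => α (Equiv.swap i j r)) (σ * Equiv.swap i j) := by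
  rw [mem_invFree_iff, mem_invFree_swap_iff]
  refine forall_compat_iff (E := rowEntry σ F)
    (E' := fun r => rowEntry (σ * Equiv.swap i j) G (Equiv.swap i j r)) hij hα
    (fun r hi hj => funext (h.1 r hi hj)) ?_ hA ?_
  · simpa using h.2
  · simpa using hB

theorem SwapRel.maj_eq (hij : (i : ℕ) + 1 = j) (hα : α j < α i) (h : SwapRel σ i j F G)
    (hF : F ∈ InvFree α σ)
    (hG : G ∈ InvFree (fun r => α (Equiv.swap i j r)) (σ * Equiv.swap i j)) :
    maj (σ * Equiv.swap i j) G = maj σ F := by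
  have hne : i ≠ j := by rintro rfl; omega
  rw [maj_eq_sum_rowMaj, maj_eq_sum_rowMaj, ← Equiv.sum_comp (Equiv.swap i j)]
  rw [sum_eq_add_add_sum hne, sum_eq_add_add_sum hne]
  simp only [Equiv.swap_apply_self, Equiv.swap_apply_left, Equiv.swap_apply_right]
  rw [rowMaj_add_eq hα h.2 ((compat_of_mem hij hF).1 hα.le) ((compat_of_mem_swap hij hG).2 hα)]
  congr 1
  refine Finset.sum_congr rfl fun r hr => ?_
  simp only [Finset.mem_compl, Finset.mem_insert, Finset.mem_singleton, not_or] at hr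
  rw [funext (h.1 r hr.1 hr.2)]

theorem SwapRel.columnSet_eq (hne : i ≠ j) (hα : α j < α i) (h : SwapRel σ i j F G) (c : ℕ) :
    columnSet (σ * Equiv.swap i j) G c = columnSet σ F c := by
  rw [columnSet_eq_sum, columnSet_eq_sum, ← Equiv.sum_comp (Equiv.swap i j)]
  rw [sum_eq_add_add_sum hne, sum_eq_add_add_sum hne]
  simp only [Equiv.swap_apply_self, Equiv.swap_apply_left, Equiv.swap_apply_right]
  congr 1
  · obtain ⟨h1, -, h3⟩ := h.2
    rcases le_or_gt c (α j) with hc | hc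
    · rw [if_pos (by omega), if_pos hc, if_pos (by omega), if_pos hc]
      rcases h1 c hc with ⟨e1, e2⟩ | ⟨e1, e2⟩ <;> rw [e1, e2]
      exact add_comm _ _
    · rw [h3 c hc, if_neg hc.not_ge, if_neg hc.not_ge]
  · refine Finset.sum_congr rfl fun r hr => ?_
    simp only [Finset.mem_compl, Finset.mem_insert, Finset.mem_singleton, not_or] at hr
    rw [h.1 r hr.1 hr.2]

theorem SwapRel.right_unique (hij : (i : ℕ) + 1 = j) (hα : α j < α i)
    (h : SwapRel σ i j F G) (h' : SwapRel σ i j F G')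
    (hG : G ∈ InvFree (fun r => α (Equiv.swap i j r)) (σ * Equiv.swap i j))
    (hG' : G' ∈ InvFree (fun r => α (Equiv.swap i j r)) (σ * Equiv.swap i j)) : G = G' := by
  have key := eq_of_compat_short_above h.2 h'.2 ((compat_of_mem_swap hij hG).2 hα)
    ((compat_of_mem_swap hij hG').2 hα)
  refine filling_ext (σ := σ * Equiv.swap i j) fun r c hc => ?_
  rcases eq_or_ne r i with rfl | hi
  · rw [Equiv.swap_apply_left] at hc
    exact (key (c + 1) hc).2
  rcases eq_or_ne r j with rfl | hj
  · rcases le_or_gt (c + 1) (α r) with h1 | h1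
    · exact (key (c + 1) h1).1
    · rw [h.2.2.2 _ h1, h'.2.2.2 _ h1]
  · have e1 := h.1 r hi hj (c + 1)
    have e2 := h'.1 r hi hj (c + 1)
    rw [Equiv.swap_apply_of_ne_of_ne hi hj] at e1 e2
    rw [e1, e2]

theorem SwapRel.left_unique (hij : (i : ℕ) + 1 = j) (hα : α j < α i)
    (h : SwapRel σ i j F G) (h' : SwapRel σ i j F' G)
    (hF : F ∈ InvFree α σ) (hF' : F' ∈ InvFree α σ) : F = F' := by
  have key := eq_of_compat_long_above h.2.symm h'.2.symm ((compat_of_mem hij hF).1 hα.le)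
    ((compat_of_mem hij hF').1 hα.le)
  refine filling_ext (σ := σ) fun r c hc => ?_
  rcases eq_or_ne r j with rfl | hj
  · exact (key (c + 1) hc).2
  rcases eq_or_ne r i with rfl | hi
  · rcases le_or_gt (c + 1) (α j) with h1 | h1
    · exact (key (c + 1) h1).1
    · rw [← h.2.2.2 _ h1, ← h'.2.2.2 _ h1]
  · rw [← h.1 r hi hj, ← h'.1 r hi hj]

theorem SamePair.exists_fin {u v u' v' : Entry n} (h : SamePair u v u' v')
    (hu : ∃ x, u = Entry.fin x) (hv : ∃ x, v = Entry.fin x) :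
    (∃ x, u' = Entry.fin x) ∧ ∃ x, v' = Entry.fin x := by
  rcases h with ⟨rfl, rfl⟩ | ⟨rfl, rfl⟩
  exacts [⟨hu, hv⟩, ⟨hv, hu⟩]

theorem exists_swapRel_right (hij : (i : ℕ) + 1 = j) (hσ : σ j < σ i) (hα : α j < α i)
    (hF : F ∈ InvFree α σ) : ∃ G, SwapRel σ i j F G ∧
      G ∈ InvFree (fun r => α (Equiv.swap i j r)) (σ * Equiv.swap i j) := by
  have hne : i ≠ j := by rintro rfl; omega
  obtain ⟨a, b, h1, h3, h4⟩ :=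
    exists_compat_short_above (α j) (rowEntry σ F i) (rowEntry σ F j)
  have ha : ∀ c, ∃ x, a (c + 1) = Entry.fin x := by
    intro c
    rcases le_or_gt (c + 1) (α j) with hc | hc
    · exact ((h1 _ hc).exists_fin (exists_rowEntry_succ F i c) (exists_rowEntry_succ F j c)).1
    · rw [h3 _ hc]
      exact exists_rowEntry_succ F i c
  -- as `∞_{σ j} < ∞_{σ i}`, the longer row keeps its basement entry
  have h0 : a 0 = Entry.inf (σ i) ∧ b 0 = Entry.inf (σ j) := by
    have h5 := h4 0 (Nat.zero_le _)
    rcases h1 0 (Nat.zero_le _) with ⟨e1, e2⟩ | ⟨e1, e2⟩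
    · exact ⟨e1, e2⟩
    · obtain ⟨x, hx⟩ := ha 0
      rw [e1, e2, hx, rowEntry_zero, rowEntry_zero, arc_inf_fin_inf] at h5
      exact absurd hσ h5
  obtain ⟨G, hG⟩ := exists_filling (α := fun r => α (Equiv.swap i j r)) (σ * Equiv.swap i j)
    (fun r => if r = j then a else if r = i then b else rowEntry σ F r)
    (by
      intro r
      split_ifs with hj hi
      · simpa [hj] using h0.1
      · simpa [hi] using h0.2
      · simp [rowEntry_zero, Equiv.swap_apply_of_ne_of_ne hi hj])
    (by
      intro r c hc
      split_ifs with hj hi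
      · exact ha c
      · rw [hi, Equiv.swap_apply_left] at hc
        exact ((h1 _ hc).exists_fin (exists_rowEntry_succ F i c)
          (exists_rowEntry_succ F j c)).2
      · exact exists_rowEntry_succ F r c)
  have hGj : ∀ c ≤ α i, rowEntry (σ * Equiv.swap i j) G j c = a c := by
    simpa using hG j
  have hGi : ∀ c ≤ α j, rowEntry (σ * Equiv.swap i j) G i c = b c := by
    simpa [hne] using hG i
  have hrel : SwapRel σ i j F G := by
    refine ⟨fun r hi hj c => ?_, fun c hc => ?_, ?_, fun c hc => ?_⟩
    · have hr := Equiv.swap_apply_of_ne_of_ne hi hj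
      rcases le_or_gt c (α r) with hc | hc
      · rw [hr, hG r c (by rwa [hr]), if_neg hj, if_neg hi]
      · rw [rowEntry_of_lt F hc, rowEntry_of_lt G (by rwa [hr, hr])]
    · rw [hGj c (by omega), hGi c hc]
      exact h1 c hc
    · rw [hGj 0 (Nat.zero_le _), h0.1, rowEntry_zero]
    · rcases le_or_gt c (α i) with hc' | hc'
      · rw [hGj c hc', h3 c hc]
      · rw [rowEntry_of_lt F hc', rowEntry_of_lt G (by rwa [Equiv.swap_apply_right])]
  refine ⟨G, hrel, (mem_invFree_iff_of_swapRel hij hα hrel (compat_of_mem hij hF) ?_).1 hF⟩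
  refine ⟨fun h => absurd h hα.not_ge, fun _ c hc => ?_⟩
  rw [hGj c (by omega), hGj (c + 1) (by omega), hGi c hc]
  exact h4 c hc

theorem exists_swapRel_left (hij : (i : ℕ) + 1 = j) (hα : α j < α i)
    (hG : G ∈ InvFree (fun r => α (Equiv.swap i j r)) (σ * Equiv.swap i j)) :
    ∃ F, SwapRel σ i j F G ∧ F ∈ InvFree α σ := by
  have hne : i ≠ j := by rintro rfl; omega
  obtain ⟨a, b, ⟨h1, h2, h3⟩, h4⟩ :=
    exists_compat_long_above (α j) (rowEntry (σ * Equiv.swap i j) G j)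
      (rowEntry (σ * Equiv.swap i j) G i)
  have h0 : a 0 = Entry.inf (σ i) ∧ b 0 = Entry.inf (σ j) := by
    have h5 := h1 0 (Nat.zero_le _)
    simp only [rowEntry_zero, Equiv.Perm.mul_apply, Equiv.swap_apply_left,
      Equiv.swap_apply_right] at h5 h2
    refine ⟨h2, ?_⟩
    rcases h5 with ⟨-, e2⟩ | ⟨e1, e2⟩
    · exact e2
    · rw [e2, ← h2, e1]
  obtain ⟨F, hF⟩ := exists_filling (α := α) σ
    (fun r => if r = i then a else if r = j then b
      else rowEntry (σ * Equiv.swap i j) G r)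
    (by
      intro r
      split_ifs with hi hj
      · simpa [hi] using h0.1
      · simpa [hj] using h0.2
      · simp [rowEntry_zero, Equiv.swap_apply_of_ne_of_ne hi hj])
    (by
      intro r c hc
      split_ifs with hi hj
      · rcases le_or_gt (c + 1) (α j) with hc | hc
        · exact ((h1 _ hc).exists_fin (exists_rowEntry_succ G j c)
            (exists_rowEntry_succ G i c)).1
        · rw [h3 _ hc]
          exact exists_rowEntry_succ G j c
      · rw [hj] at hc
        exact ((h1 _ hc).exists_fin (exists_rowEntry_succ G j c)
          (exists_rowEntry_succ G i c)).2
      · exact exists_rowEntry_succ G r c)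
  have hFi : ∀ c ≤ α i, rowEntry σ F i c = a c := by
    simpa using hF i
  have hFj : ∀ c ≤ α j, rowEntry σ F j c = b c := by
    simpa [hne.symm] using hF j
  have hrel : SwapRel σ i j F G := by
    refine ⟨fun r hi hj c => ?_, fun c hc => ?_, ?_, fun c hc => ?_⟩
    · have hr := Equiv.swap_apply_of_ne_of_ne hi hj
      rcases le_or_gt c (α r) with hc | hc
      · rw [hr, hF r c hc, if_neg hi, if_neg hj]
      · rw [rowEntry_of_lt F hc, rowEntry_of_lt G (by rwa [hr, hr])]
    · rw [hFi c (by omega), hFj c hc]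
      exact (h1 c hc).symm
    · rw [hFi 0 (Nat.zero_le _), h2]
    · rcases le_or_gt c (α i) with hc' | hc'
      · rw [hFi c hc', h3 c hc]
      · rw [rowEntry_of_lt F hc', rowEntry_of_lt G (by rwa [Equiv.swap_apply_right])]
  refine ⟨F, hrel, (mem_invFree_iff_of_swapRel hij hα hrel ?_ (compat_of_mem_swap hij hG)).2 hG⟩
  refine ⟨fun _ c hc => ?_, fun h => absurd h hα.not_gt⟩
  rw [hFi c (by omega), hFi (c + 1) (by omega), hFj (c + 1) hc]
  exact h4 c hc

end Fillings

theorem exists_equiv_of_existsUnique {A B : Type*} {R : A → B → Prop} (h : ∀ a, ∃! b, R a b)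
    (h' : ∀ b, ∃! a, R a b) : ∃ φ : A ≃ B, ∀ a, R a (φ a) := by
  choose f hf hf' using h
  choose g hg hg' using h'
  exact ⟨⟨f, g, fun a => (hg' _ a (hf a)).symm, fun b => (hf' _ b (hg b)).symm⟩, hf⟩

end BigBasement

theorem mainTheorem2 {n : ℕ} (α : Fin n → ℕ) (σ : Equiv.Perm (Fin n)) (i j : Fin n)
    (hij : (i : ℕ) + 1 = (j : ℕ)) (hσ : σ j < σ i) (hα : α j ≤ α i) :
    ∃ φ : BigBasement.InvFree α σ ≃
        BigBasement.InvFree (fun r => α (Equiv.swap i j r)) (σ * Equiv.swap i j),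
      ∀ F : BigBasement.InvFree α σ,
        (∀ c : ℕ, BigBasement.columnSet (σ * Equiv.swap i j) (φ F).1 c =
          BigBasement.columnSet σ F.1 c) ∧
        BigBasement.maj (σ * Equiv.swap i j) (φ F).1 = BigBasement.maj σ F.1 := by
  open BigBasement in
  rcases hα.lt_or_eq with hlt | heq
  · obtain ⟨φ, hφ⟩ := exists_equiv_of_existsUnique
      (A := InvFree α σ) (B := InvFree (fun r => α (Equiv.swap i j r)) (σ * Equiv.swap i j))
      (R := fun F G => SwapRel σ i j F.1 G.1)
      (fun F => by
        obtain ⟨G, hG, hmem⟩ := exists_swapRel_right hij hσ hlt F.2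
        exact ⟨⟨G, hmem⟩, hG, fun G' hG' =>
          Subtype.ext (SwapRel.right_unique hij hlt hG' hG G'.2 hmem)⟩)
      (fun G => by
        obtain ⟨F, hF, hmem⟩ := exists_swapRel_left hij hlt G.2
        exact ⟨⟨F, hmem⟩, hF, fun F' hF' =>
          Subtype.ext (SwapRel.left_unique hij hlt hF' hF F'.2 hmem)⟩)
    exact ⟨φ, fun F => ⟨(hφ F).columnSet_eq (by rintro rfl; omega) hlt,
      (hφ F).maj_eq hij hlt F.2 (φ F).2⟩⟩
  · refine exists_equiv_of_eq hij heq.symm (funext fun r => ?_)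
    rw [Equiv.swap_apply_def]
    split_ifs with h1 h2 <;> simp_all
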